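/- Let $G$ be a totally disconnected group (locally compact, Hausdorff). All spaces are Hausdorff, maps are continuous, and a $G$-space is a space with a continuous $G$-action. Let $\mathcal{COM}$ be the set of compact subgroups of $G$ and $\mathcal{COMOP}$ the set of compact open subgroups of $G$. Let $\mathcal F$ be a family of subgroups of $G$, i.e. a set of closed subgroups that is closed under conjugation and finite intersections, and suppose that $\mathcal{COMOP}\subseteq\mathcal F\subseteq\mathcal{COM}$. For a family $\mathcal H$ of subgroups, a model for $E_{\mathcal H}(G)$ is a $G$-CW-complex all of whose isotropy groups belong to $\mathcal H$, and to which every $G$-CW-complex with isotropy groups in $\mathcal H$ admits up to $G$-homotopy precisely one $G$-map. A $G$-space $X$ is $\mathcal H$-numerable if it has an open covering $\{U_i\}_{i\in I}$ by $G$-invariant subsets, each with a $G$-map $U_i\to G/G_i$ for some $G_i\in\mathcal H$, and a locally finite partition of unity $\{e_i\}_{i\in I}$ subordinate to $\{U_i\}_{i\in I}$ by $G$-invariant functions $e_i\colon X\to[0,1]$. A model for $J_{\mathcal H}(G)$ is an $\mathcal H$-numerable $G$-space to which every $\mathcal H$-numerable $G$-space admits up to $G$-homotopy precisely one $G$-map.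 Then every compact subgroup of $G$ is contained in a compact open subgroup of $G$. Moreover, for all models of the four spaces below there is, for each edge of the square $$\begin{array}{ccc} E_{\mathcal{COMOP}}(G) & \longrightarrow & J_{\mathcal{COMOP}}(G)\\ \downarrow & & \downarrow\\ E_{\mathcal F}(G) & \longrightarrow & J_{\mathcal F}(G)\end{array}$$ up to $G$-homotopy precisely one $G$-map in the indicated direction; with these maps the square commutes up to $G$-homotopy, and all four maps are $G$-homotopy equivalences. -/

import Mathlib

universe u

/-- A `G`-map: a continuous `G`-equivariant map between `G`-spaces. -/
structure GMap (G X Y : Type*) [Group G] [TopologicalSpace X] [MulAction G X]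
    [TopologicalSpace Y] [MulAction G Y] extends C(X, Y) where
  map_smul' : ∀ (g : G) (x : X), toFun (g • x) = g • toFun x

/-- The identity `G`-map. -/
def GMap.id (G X : Type*) [Group G] [TopologicalSpace X] [MulAction G X] : GMap G X X where
  toContinuousMap := ContinuousMap.id X
  map_smul' _ _ := rfl

/-- The composition `k ∘ f` of `G`-maps. -/
def GMap.comp {G X Y Z : Type*} [Group G] [TopologicalSpace X] [MulAction G X]
    [TopologicalSpace Y] [MulAction G Y] [TopologicalSpace Z] [MulAction G Z]
    (k : GMap G Y Z) (f : GMap G X Y) : GMap G X Z where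
  toContinuousMap := k.toContinuousMap.comp f.toContinuousMap
  map_smul' g x :=
    (congrArg k.toFun (f.map_smul' g x)).trans (k.map_smul' g (f.toFun x))

/-- Two `G`-maps are `G`-homotopic: there is a homotopy between them that is equivariant
for the trivial action of `G` on the unit interval. -/
def GHomotopic {G X Y : Type*} [Group G] [TopologicalSpace X] [MulAction G X]
    [TopologicalSpace Y] [MulAction G Y] (f₀ f₁ : GMap G X Y) : Prop :=
  ∃ h : ContinuousMap.Homotopy f₀.toContinuousMap f₁.toContinuousMap,
    ∀ (g : G) (t : unitInterval) (x : X), h (t, g • x) = g • h (t, x)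

/-- A `G`-map is a `G`-homotopy equivalence if it has a `G`-homotopy inverse. -/
def IsGHomotopyEquiv {G X Y : Type*} [Group G] [TopologicalSpace X] [MulAction G X]
    [TopologicalSpace Y] [MulAction G Y] (f : GMap G X Y) : Prop :=
  ∃ k : GMap G Y X, GHomotopic (k.comp f) (GMap.id G X) ∧ GHomotopic (f.comp k) (GMap.id G Y)

/-- Up to `G`-homotopy there is precisely one `G`-map `X → Y`. -/
def HasUniqueGMap (G X Y : Type*) [Group G] [TopologicalSpace X] [MulAction G X]
    [TopologicalSpace Y] [MulAction G Y] : Prop :=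
  Nonempty (GMap G X Y) ∧ ∀ f₀ f₁ : GMap G X Y, GHomotopic f₀ f₁

/-- A family of subgroups of a topological group: a set of closed subgroups that is closed
under conjugation and (nonempty) finite intersections. -/
structure IsSubgroupFamily {G : Type*} [Group G] [TopologicalSpace G]
    (F : Set (Subgroup G)) : Prop where
  isClosed : ∀ H ∈ F, IsClosed (H : Set G)
  conj : ∀ H ∈ F, ∀ g : G, H.map (MulAut.conj g).toMonoidHom ∈ F
  inter : ∀ H ∈ F, ∀ K ∈ F, H ⊓ K ∈ F

/-- The compact subgroups of `G`. -/
def compactSubgroups (G : Type*) [Group G] [TopologicalSpace G] : Set (Subgroup G) :=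
  {H | IsCompact (H : Set G)}

/-- The compact open subgroups of `G`. -/
def compactOpenSubgroups (G : Type*) [Group G] [TopologicalSpace G] : Set (Subgroup G) :=
  {H | IsCompact (H : Set G) ∧ IsOpen (H : Set G)}

/-- The closed unit disk `Dⁿ`, as a set in `ℝⁿ`; its boundary sphere `Sⁿ⁻¹` is
`Metric.sphere 0 1` and its interior is `Metric.ball 0 1`. For `n = 0` these are a point,
the empty set and a point. -/
abbrev unitDisk (n : ℕ) : Set (EuclideanSpace ℝ (Fin n)) := Metric.closedBall 0 1

/-- The subspace `B` of the `G`-space `X` is obtained from the subspace `A` by attaching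
equivariant `n`-cells `G/H i × Dⁿ`. The `G`-maps `Q i : G/H i × Dⁿ → B` send `G/H i × Sⁿ⁻¹`
to `A` (this restriction is the attaching map), and the square
`∐ G/H i × Sⁿ⁻¹ → A`, `∐ G/H i × Dⁿ → B` is a pushout: as a set `B` is the disjoint union of
`A` and the open cells, and `B` carries the quotient topology of `A ⊔ ∐ G/H i × Dⁿ`. -/
def AttachesGCells (G : Type u) [Group G] [TopologicalSpace G] {X : Type u}
    [TopologicalSpace X] [MulAction G X] (n : ℕ) (A B : Set X) : Prop :=
  ∃ (hAB : A ⊆ B) (ι : Type u) (H : ι → Subgroup G)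
    (Q : ∀ i, (G ⧸ H i) × unitDisk n → B),
    (∀ i, IsClosed (H i : Set G)) ∧
    (∀ i, Continuous (Q i)) ∧
    (∀ i (g : G) (a : G ⧸ H i) (v : unitDisk n), (Q i (g • a, v) : X) = g • (Q i (a, v) : X)) ∧
    (∀ i (a : G ⧸ H i) (v : unitDisk n),
      (v : EuclideanSpace ℝ (Fin n)) ∈ Metric.sphere 0 1 → (Q i (a, v) : X) ∈ A) ∧
    Set.BijOn (fun p : Σ i, (G ⧸ H i) × unitDisk n => (Q p.1 p.2 : X))
      {p | (p.2.2 : EuclideanSpace ℝ (Fin n)) ∈ Metric.ball 0 1} (B \ A) ∧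
    Topology.IsQuotientMap
      (Sum.elim (Set.inclusion hAB) (fun p : Σ i, (G ⧸ H i) × unitDisk n => Q p.1 p.2))

/-- The `G`-space `X` is a `G`-CW-complex: it has a `G`-invariant filtration
`∅ = X₋₁ ⊆ X₀ ⊆ X₁ ⊆ ⋯` with union `X` (here `sk n` is `Xₙ₋₁`), it carries the colimit topology,
and `Xₙ` is obtained from `Xₙ₋₁` by attaching equivariant `n`-cells. -/
def IsGCWComplex (G : Type u) [Group G] [TopologicalSpace G] (X : Type u)
    [TopologicalSpace X] [MulAction G X] : Prop :=
  ∃ sk : ℕ → Set X,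
    sk 0 = ∅ ∧
    Monotone sk ∧
    (∀ n (g : G), ∀ x ∈ sk n, g • x ∈ sk n) ∧
    (⋃ n, sk n) = Set.univ ∧
    (∀ C : Set X, IsClosed C ↔ ∀ n, IsClosed ((↑) ⁻¹' C : Set (sk n))) ∧
    ∀ n, AttachesGCells G n (sk n) (sk (n + 1))

/-- The `G`-space `X` is `F`-numerable: it has an open covering by `G`-invariant subsets `U i`,
each with a `G`-map `φ i : U i → G/K i` for some `K i ∈ F`, and a subordinate locally finite
partition of unity by `G`-invariant functions. (The values of `φ i` outside `U i` play no
role.) -/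
def IsNumerableGSpace {G : Type u} [Group G] [TopologicalSpace G] (F : Set (Subgroup G))
    (X : Type u) [TopologicalSpace X] [MulAction G X] : Prop :=
  ∃ (ι : Type u) (U : ι → Set X) (K : ι → Subgroup G) (φ : ∀ i, X → G ⧸ K i)
    (e : PartitionOfUnity ι X),
    (∀ i, IsOpen (U i)) ∧
    (∀ i (g : G), ∀ x ∈ U i, g • x ∈ U i) ∧
    (⋃ i, U i) = Set.univ ∧
    (∀ i, K i ∈ F) ∧
    (∀ i, ContinuousOn (φ i) (U i)) ∧
    (∀ i (g : G), ∀ x ∈ U i, φ i (g • x) = g • φ i x) ∧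
    e.IsSubordinate U ∧
    ∀ i (g : G) (x : X), e i (g • x) = e i x

/-- The `G`-space `E` is a model for the classifying `G`-CW-complex `E_F(G)`. -/
structure IsClassifyingGCW {G : Type u} [Group G] [TopologicalSpace G] (F : Set (Subgroup G))
    (E : Type u) [TopologicalSpace E] [MulAction G E] : Prop where
  isGCWComplex : IsGCWComplex G E
  isotropy : ∀ x : E, MulAction.stabilizer G x ∈ F
  universal : ∀ (Y : Type u) [TopologicalSpace Y] [T2Space Y] [MulAction G Y]
    [ContinuousSMul G Y], IsGCWComplex G Y → (∀ y : Y, MulAction.stabilizer G y ∈ F) →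
    HasUniqueGMap G Y E

/-- The `G`-space `J` is a model for the classifying numerable `G`-space `J_F(G)`. -/
structure IsClassifyingNumerable {G : Type u} [Group G] [TopologicalSpace G]
    (F : Set (Subgroup G)) (J : Type u) [TopologicalSpace J] [MulAction G J] : Prop where
  isNumerable : IsNumerableGSpace F J
  universal : ∀ (Y : Type u) [TopologicalSpace Y] [T2Space Y] [MulAction G Y]
    [ContinuousSMul G Y], IsNumerableGSpace F Y → HasUniqueGMap G Y J

/-! The argument needs only enough `G`-maps. Self-maps of a model are unique up to `G`-homotopy, so
a map between two models is an equivalence as soon as some map in the opposite direction exists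
(`isGHomotopyEquiv_of_hasUniqueGMap`).

Since a compact subgroup `H` lies in a compact open `K` (`exists_compactOpenSubgroup_ge`), composing
with `G/H → G/K` shows that being `F`-numerable and being numerable for the compact open subgroups
are the same property.

From CW to numerable: `G/H × Y` with `H` compact and trivial action on `Y` is numerable through its
map to `G/K`, so it has a unique map to `J₀` up to homotopy. This extends `G`-maps into `J₀` over
cells, and every `G`-CW-complex with compact isotropy maps to `J₀` (`IsGCWComplex.nonempty_gMap`).
Pulling back the numeration makes `E₀` and `E` numerable.

From numerable to CW: a partition of unity with compact open `K i` defines a `G`-map to a nerve, the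
`RainbowComplex`. This is a `G`-CW-complex with compact open isotropy, hence maps to `E₀`. -/

/-! ### Compact subgroups inside compact open subgroups. -/

section Subgroups

open scoped Pointwise

variable {G : Type*} [Group G] [TopologicalSpace G] [IsTopologicalGroup G]

/-- In a locally compact totally disconnected group every compact subgroup is contained in a
compact open one, namely in the left stabilizer of a compact open set of the form `H * W`. -/
theorem exists_compactOpenSubgroup_ge [LocallyCompactSpace G] [T2Space G]
    [TotallyDisconnectedSpace G] (H : Subgroup G) (hH : IsCompact (H : Set G)) :
    ∃ K ∈ compactOpenSubgroups G, H ≤ K := by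
  obtain ⟨C, hC, hC1⟩ := exists_compact_mem_nhds (1 : G)
  obtain ⟨W, hW, hW1, hWC⟩ := (loc_compact_Haus_tot_disc_of_zero_dim (H := G)).mem_nhds_iff.1 hC1
  have hWo : IsOpen W := hW.isOpen
  have hWc : IsCompact W := hC.of_isClosed_subset hW.isClosed hWC
  -- `S` is compact, open, contains `1` and is invariant under left translation by `H`, so its left
  -- stabilizer contains `H`.
  let S : Set G := (H : Set G) * W
  have hSo : IsOpen S := hWo.mul_left
  have hSc : IsCompact S := hH.mul hWc
  have hS1 : (1 : G) ∈ S := ⟨1, H.one_mem, 1, hW1, by simp⟩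
  obtain ⟨T, hT, hTS⟩ := compact_open_separated_mul_left hSc hSo subset_rfl
  let K : Subgroup G :=
    { carrier := {g | ∀ s, g * s ∈ S ↔ s ∈ S}
      one_mem' := by simp
      mul_mem' := fun {a b} ha hb s => by rw [mul_assoc, ha, hb]
      inv_mem' := fun {a} ha s => by
        rw [← ha (a⁻¹ * s), mul_inv_cancel_left] }
  have hKo : IsOpen (K : Set G) := by
    refine K.isOpen_of_mem_nhds (g := 1) ?_
    -- Both `g` and `g⁻¹` are taken in `T`, because stabilizing `S` is an equivalence.
    filter_upwards [hT, inv_mem_nhds_one G hT] with g hg hg' s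
    refine ⟨fun h => ?_, fun h => hTS ⟨g, hg, s, h, rfl⟩⟩
    simpa using hTS ⟨g⁻¹, hg', g * s, h, rfl⟩
  refine ⟨K, ⟨hSc.of_isClosed_subset (K.isClosed_of_isOpen hKo) fun g hg => ?_, hKo⟩, ?_⟩
  -- As `1 ∈ S`, the group `K` lies inside the compact set `S`.
  · simpa using (hg 1).2 hS1
  · rintro h hh s
    refine ⟨fun ⟨h', hh', w, hw, e⟩ => ⟨h⁻¹ * h', H.mul_mem (H.inv_mem hh) hh', w, hw, ?_⟩,
      fun ⟨h', hh', w, hw, e⟩ => ⟨h * h', H.mul_mem hh hh', w, hw, ?_⟩⟩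
    · simp only at e ⊢; rw [mul_assoc, e, inv_mul_cancel_left]
    · simp only at e ⊢; rw [mul_assoc, e]

end Subgroups

/-! ### Equivalences from uniqueness of maps. -/

section Homotopy

variable {G X Y : Type*} [Group G] [TopologicalSpace X] [MulAction G X]
    [TopologicalSpace Y] [MulAction G Y]

/-- Spaces that map uniquely to each other and to themselves up to `G`-homotopy are
`G`-homotopy equivalent through any `G`-map. -/
theorem isGHomotopyEquiv_of_hasUniqueGMap (hX : HasUniqueGMap G X X) (hY : HasUniqueGMap G Y Y)
    (h : Nonempty (GMap G Y X)) (f : GMap G X Y) : IsGHomotopyEquiv f :=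
  ⟨h.some, hX.2 _ _, hY.2 _ _⟩

end Homotopy

/-! ### Numerable `G`-spaces. -/

section Numerable

variable {G : Type u} [Group G] [TopologicalSpace G]

/-- Through this a `G`-CW-complex becomes numerable once it maps to a numerable space; no partition
of unity is built on cells. -/
theorem IsNumerableGSpace.comap {F : Set (Subgroup G)} {X Y : Type u} [TopologicalSpace X]
    [MulAction G X] [TopologicalSpace Y] [MulAction G Y] (hY : IsNumerableGSpace F Y)
    (f : GMap G X Y) : IsNumerableGSpace F X := by
  obtain ⟨ι, U, K, φ, e, hU, hUG, hUc, hK, hφ, hφG, he, heG⟩ := hY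
  have hf : Continuous f.toFun := f.continuous_toFun
  refine ⟨ι, fun i => f.toFun ⁻¹' U i, K, fun i => φ i ∘ f.toFun,
    { toFun := fun i => (e i).comp f.toContinuousMap
      locallyFinite' := e.locallyFinite.preimage_continuous hf
      nonneg' := fun i x => e.nonneg i _
      sum_eq_one' := fun x _ => e.sum_eq_one (Set.mem_univ (f.toFun x))
      sum_le_one' := fun x => e.sum_le_one (f.toFun x) },
    fun i => (hU i).preimage hf, fun i g x hx => ?_, ?_, hK, fun i => ?_, fun i g x hx => ?_,
    fun i => ?_, fun i g x => ?_⟩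
  · simpa only [Set.mem_preimage, f.map_smul'] using hUG i g _ hx
  · rw [← Set.preimage_iUnion, hUc, Set.preimage_univ]
  · exact (hφ i).comp hf.continuousOn fun x hx => hx
  · simpa only [Function.comp, f.map_smul'] using hφG i g _ hx
  · exact (tsupport_comp_subset_preimage (e i) hf).trans (Set.preimage_mono (he i))
  · exact (congrArg (e i) (f.map_smul' g x)).trans (heG i g _)

/-- The charts are composed with the projections `G/H → G/K`; cover and partition stay the same. -/
theorem IsNumerableGSpace.mono_of_le {F F' : Set (Subgroup G)}
    (h : ∀ H ∈ F, ∃ K ∈ F', H ≤ K) {X : Type u} [TopologicalSpace X] [MulAction G X]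
    (hX : IsNumerableGSpace F X) : IsNumerableGSpace F' X := by
  obtain ⟨ι, U, K, φ, e, hU, hUG, hUc, hK, hφ, hφG, he, heG⟩ := hX
  choose! L hL hKL using h
  have hq : ∀ i, Continuous (Subgroup.quotientMapOfLE (hKL (K i) (hK i))) := fun i =>
    continuous_quot_mk.quotient_lift _
  refine ⟨ι, U, fun i => L (K i), fun i x => Subgroup.quotientMapOfLE (hKL _ (hK i)) (φ i x),
    e, hU, hUG, hUc, fun i => hL _ (hK i), fun i => (hq i).comp_continuousOn (hφ i),
    fun i g x hx => ?_, he, heG⟩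
  simp only [hφG i g x hx]
  induction φ i x using QuotientGroup.induction_on with
  | H a => rfl

theorem isNumerableGSpace_of_gMap {F : Set (Subgroup G)} {X : Type u} [TopologicalSpace X]
    [MulAction G X] {K : Subgroup G} (hK : K ∈ F) (φ : X → G ⧸ K) (hφ : Continuous φ)
    (hφG : ∀ (g : G) x, φ (g • x) = g • φ x) : IsNumerableGSpace F X := by
  refine ⟨PUnit, fun _ => Set.univ, fun _ => K, fun _ => φ,
    { toFun := fun _ => 1
      locallyFinite' := locallyFinite_of_finite _
      nonneg' := fun i x => zero_le_one
      sum_eq_one' := fun x _ => by simp [finsum_eq_sum_of_fintype]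
      sum_le_one' := fun x => by simp [finsum_eq_sum_of_fintype] },
    fun _ => isOpen_univ, fun _ _ _ _ => trivial, Set.iUnion_const _, fun _ => hK,
    fun _ => hφ.continuousOn, fun _ g x _ => hφG g x, fun _ => Set.subset_univ _,
    fun _ _ _ => rfl⟩

end Numerable

/-- The space `Y` (moved to the universe of `G`) with the trivial action of `G`. -/
def TrivialGSpace (_G : Type u) (Y : Type) : Type u := ULift.{u} Y

namespace TrivialGSpace

variable {G : Type u} {Y : Type}

instance [TopologicalSpace Y] : TopologicalSpace (TrivialGSpace G Y) :=
  inferInstanceAs (TopologicalSpace (ULift.{u} Y))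

instance [TopologicalSpace Y] [T2Space Y] : T2Space (TrivialGSpace G Y) :=
  inferInstanceAs (T2Space (ULift.{u} Y))

instance [Group G] : MulAction G (TrivialGSpace G Y) where
  smul _ y := y
  one_smul _ := rfl
  mul_smul _ _ _ := rfl

instance [Group G] [TopologicalSpace G] [TopologicalSpace Y] :
    ContinuousSMul G (TrivialGSpace G Y) := ⟨continuous_snd⟩

end TrivialGSpace

/-! ### Numerability of orbits. -/

section Orbits

variable {G : Type u} [Group G] [TopologicalSpace G] [IsTopologicalGroup G]
  [LocallyCompactSpace G] [T2Space G] [TotallyDisconnectedSpace G]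

/-- `H` need not be open: a single chart `G/H × Y → G/H → G/K` with `K` compact open suffices. -/
theorem isNumerableGSpace_quotient_prod (H : Subgroup G) (hH : IsCompact (H : Set G))
    (Y : Type u) [TopologicalSpace Y] [MulAction G Y] :
    IsNumerableGSpace (compactOpenSubgroups G) ((G ⧸ H) × Y) := by
  obtain ⟨K, hK, hHK⟩ := exists_compactOpenSubgroup_ge H hH
  refine isNumerableGSpace_of_gMap hK (fun p => Subgroup.quotientMapOfLE hHK p.1)
    ((continuous_quot_mk.quotient_lift _).comp continuous_fst) fun g x => ?_
  obtain ⟨a, y⟩ := x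
  induction a using QuotientGroup.induction_on with
  | H a => rfl

end Orbits

/-! ### Extending `G`-maps cell by cell. -/

section Extension

variable {G : Type u} [Group G] [TopologicalSpace G]

/-- Equivariant maps defined on `G/H × Sⁿ⁻¹` extend over `G/H × Dⁿ` if the target sees all the
spaces `G/H × Y` as points over `G/H`. -/
theorem exists_extension_disk {T : Type u} [TopologicalSpace T] [MulAction G T]
    (H : Subgroup G)
    (hT : ∀ (Y : Type) [TopologicalSpace Y] [T2Space Y],
      HasUniqueGMap G ((G ⧸ H) × TrivialGSpace G Y) T) (n : ℕ)
    (f : (G ⧸ H) × Metric.sphere (0 : EuclideanSpace ℝ (Fin n)) 1 → T) (hf : Continuous f)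
    (hfG : ∀ (g : G) a v, f (g • a, v) = g • f (a, v)) :
    ∃ F : (G ⧸ H) × unitDisk n → T, Continuous F ∧
      (∀ (g : G) a v, F (g • a, v) = g • F (a, v)) ∧
      ∀ a (v : unitDisk n) (hv : (v : EuclideanSpace ℝ (Fin n)) ∈ Metric.sphere 0 1),
        F (a, v) = f (a, ⟨v, hv⟩) := by
  -- Existence for a point gives the value `γ` at the centre of the disk; uniqueness for the sphere
  -- gives a homotopy from `γ` to `f`, whose time becomes the radius.
  obtain ⟨⟨c⟩, -⟩ := hT Unit
  let γ : G ⧸ H → T := fun a => c.toFun (a, ULift.up ())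
  have hγ : Continuous γ := c.continuous_toFun.comp (by fun_prop)
  have hγG : ∀ (g : G) a, γ (g • a) = g • γ a := fun g a => c.map_smul' g (a, ULift.up ())
  let S := Metric.sphere (0 : EuclideanSpace ℝ (Fin n)) 1
  let f₀ : GMap G ((G ⧸ H) × TrivialGSpace G S) T :=
    { toFun := fun p => γ p.1
      continuous_toFun := hγ.comp continuous_fst
      map_smul' := fun g p => hγG g p.1 }
  let f₁ : GMap G ((G ⧸ H) × TrivialGSpace G S) T :=
    { toFun := fun p => f (p.1, p.2.down)
      continuous_toFun :=
        hf.comp (continuous_fst.prodMk (continuous_uliftDown.comp continuous_snd))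
      map_smul' := fun g p => hfG g p.1 p.2.down }
  obtain ⟨h, hG⟩ := (hT S).2 f₀ f₁
  have h0 : ∀ a s, h (0, (a, ULift.up s)) = γ a := fun a s => h.apply_zero (a, ULift.up s)
  have h1 : ∀ a s, h (1, (a, ULift.up s)) = f (a, s) := fun a s => h.apply_one (a, ULift.up s)
  have hsph : ∀ v : EuclideanSpace ℝ (Fin n), v ≠ 0 → ‖v‖⁻¹ • v ∈ S := fun v hv => by
    simp [S, norm_smul, hv]
  classical
  let F : (G ⧸ H) × unitDisk n → T := fun p =>
    if hv : (p.2 : EuclideanSpace ℝ (Fin n)) = 0 then γ p.1 else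
      h (⟨‖(p.2 : EuclideanSpace ℝ (Fin n))‖, norm_nonneg _, mem_closedBall_zero_iff.1 p.2.2⟩,
        (p.1, ULift.up ⟨_, hsph _ hv⟩))
  refine ⟨F, ?_, fun g a v => ?_, fun a v hv => ?_⟩
  -- The sphere is empty exactly for `n = 0`, when polar coordinates do not reach the centre.
  · rcases isEmpty_or_nonempty S with hS | hS
    · have : F = fun p => γ p.1 := by
        funext p
        simp only [F]
        rw [dif_pos]
        by_contra hv
        exact hS.elim ⟨_, hsph _ hv⟩
      rw [this]
      exact hγ.comp continuous_fst
    · let q : unitInterval × S → unitDisk n := fun p => ⟨(p.1 : ℝ) • (p.2 : EuclideanSpace ℝ _), by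
        have : ‖(p.2 : EuclideanSpace ℝ (Fin n))‖ = 1 := by simp
        simpa [norm_smul, this, abs_of_nonneg p.1.2.1] using p.1.2.2⟩
      have hq : Continuous q := by fun_prop
      have hqs : Function.Surjective q := by
        intro v
        by_cases hv : (v : EuclideanSpace ℝ (Fin n)) = 0
        · exact ⟨(0, hS.some), by ext1; simp [q, hv]⟩
        · refine ⟨(⟨‖(v : EuclideanSpace ℝ (Fin n))‖, norm_nonneg _, mem_closedBall_zero_iff.1 v.2⟩,
            ⟨_, hsph _ hv⟩), ?_⟩
          ext1
          simp [q, smul_smul, hv]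
      -- The polar map `q` is proper, so its product with `G/H` is still closed and continuity can
      -- be tested in polar coordinates.
      have hQ : Topology.IsQuotientMap (Prod.map (id : G ⧸ H → G ⧸ H) q) :=
        (isProperMap_id.prodMap hq.isProperMap).isClosedMap.isQuotientMap
          (continuous_id.prodMap hq) (Function.surjective_id.prodMap hqs)
      rw [hQ.continuous_iff]
      have : F ∘ Prod.map (id : G ⧸ H → G ⧸ H) q = fun p => h (p.2.1, (p.1, ULift.up p.2.2)) := by
        funext ⟨a, t, s⟩
        have hs : ‖(s : EuclideanSpace ℝ (Fin n))‖ = 1 := by simp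
        have hs0 : (s : EuclideanSpace ℝ (Fin n)) ≠ 0 := by
          rw [← norm_ne_zero_iff, hs]; exact one_ne_zero
        simp only [Function.comp, Prod.map, id, F, q]
        by_cases ht : t = 0
        · subst ht
          rw [dif_pos (by simp), h0]
        · have ht' : (t : ℝ) ≠ 0 := fun e => ht (Subtype.ext e)
          rw [dif_neg (smul_ne_zero ht' hs0)]
          congr 2
          · ext1
            simp [norm_smul, hs, abs_of_nonneg t.2.1]
          · congr 2
            ext1
            simp only [norm_smul, hs, Real.norm_eq_abs, abs_of_nonneg t.2.1, mul_one]
            rw [smul_smul, inv_mul_cancel₀ ht', one_smul]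
      rw [this]
      exact h.continuous.comp (continuous_snd.fst.prodMk
        (continuous_fst.prodMk (continuous_uliftUp.comp continuous_snd.snd)))
  · simp only [F]
    split_ifs with hv
    · exact hγG g a
    · exact hG g _ (a, _)
  · have hn : ‖(v : EuclideanSpace ℝ (Fin n))‖ = 1 := by simpa using hv
    have hv0 : (v : EuclideanSpace ℝ (Fin n)) ≠ 0 := by
      rw [← norm_ne_zero_iff, hn]; exact one_ne_zero
    simp only [F]
    rw [dif_neg hv0, ← h1]
    congr 2
    · ext1; exact hn
    · congr 2; ext1; simp [hn]

/-- Extension of an equivariant map over attached equivariant cells. -/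
theorem AttachesGCells.exists_extension {X T : Type u} [TopologicalSpace X] [MulAction G X]
    [TopologicalSpace T] [MulAction G T] {n : ℕ} {A B : Set X} (hAB : AttachesGCells G n A B)
    (hT : ∀ H : Subgroup G, (∃ x : X, MulAction.stabilizer G x = H) →
      ∀ (Y : Type) [TopologicalSpace Y] [T2Space Y],
      HasUniqueGMap G ((G ⧸ H) × TrivialGSpace G Y) T)
    (hA : ∀ (g : G), ∀ x ∈ A, g • x ∈ A)
    (f : X → T) (hf : ContinuousOn f A) (hfG : ∀ (g : G), ∀ x ∈ A, f (g • x) = g • f x) :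
    ∃ f' : X → T, ContinuousOn f' B ∧ (∀ (g : G), ∀ x ∈ B, f' (g • x) = g • f' x) ∧
      Set.EqOn f' f A := by
  obtain ⟨hsub, ι, H, Q, hHc, hQ, hQG, hQA, hbij, hquot⟩ := hAB
  have hA' : ∀ (g : G) x, g • x ∈ A ↔ x ∈ A := fun g x =>
    ⟨fun h => by simpa using hA g⁻¹ _ h, hA g x⟩
  have h0 : (0 : EuclideanSpace ℝ (Fin n)) ∈ Metric.closedBall (0 : EuclideanSpace ℝ (Fin n)) 1 :=
    by simp
  -- The centre of a cell is an interior point, where `Q` is injective; thus every `H i` is an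
  -- isotropy group and `hT` applies.
  have hstab : ∀ i, MulAction.stabilizer G (Q i ((1 : G), ⟨0, h0⟩) : X) = H i := by
    intro i
    ext g
    rw [MulAction.mem_stabilizer_iff, ← hQG]
    constructor
    · intro h
      have := hbij.injOn (x₁ := ⟨i, (g • ((1 : G) : G ⧸ H i), ⟨0, h0⟩)⟩)
        (x₂ := ⟨i, (((1 : G) : G ⧸ H i), ⟨0, h0⟩)⟩) (by simp) (by simp) h
      simp only [Sigma.mk.injEq, heq_eq_eq, Prod.mk.injEq, true_and, and_true] at this
      rw [MulAction.Quotient.smul_coe, QuotientGroup.eq] at this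
      simpa using this
    · intro h
      have : g • ((1 : G) : G ⧸ H i) = ((1 : G) : G ⧸ H i) := by
        rw [MulAction.Quotient.smul_coe, QuotientGroup.eq]
        simpa using h
      rw [this]
  have hext : ∀ i, ∃ F : (G ⧸ H i) × unitDisk n → T, Continuous F ∧
      (∀ (g : G) a v, F (g • a, v) = g • F (a, v)) ∧
      ∀ a (v : unitDisk n) (_ : (v : EuclideanSpace ℝ (Fin n)) ∈ Metric.sphere 0 1),
        F (a, v) = f (Q i (a, v)) := by
    intro i
    obtain ⟨F, hF, hFG, hFe⟩ := exists_extension_disk (H i) (hT (H i) ⟨_, hstab i⟩) n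
      (fun p => f (Q i (p.1, ⟨p.2, Metric.sphere_subset_closedBall p.2.2⟩)))
      (hf.comp_continuous (continuous_subtype_val.comp ((hQ i).comp (by fun_prop)))
        fun p => hQA i p.1 ⟨p.2, _⟩ p.2.2)
      (fun g a v => by rw [hQG, hfG g _ (hQA i a ⟨v, _⟩ v.2)])
    exact ⟨F, hF, hFG, fun a v hv => hFe a v hv⟩
  choose F hF hFG hFe using hext
  have hpre : ∀ x : X, x ∈ B → x ∉ A → ∃ p : Σ i, (G ⧸ H i) × unitDisk n,
      (p.2.2 : EuclideanSpace ℝ (Fin n)) ∈ Metric.ball 0 1 ∧ (Q p.1 p.2 : X) = x :=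
    fun x hB hA => hbij.surjOn ⟨hB, hA⟩
  classical
  let f' : X → T := fun x => if hx : x ∈ B ∧ x ∉ A then
    F (hpre x hx.1 hx.2).choose.1 (hpre x hx.1 hx.2).choose.2 else f x
  have hf'A : Set.EqOn f' f A := fun x hx => dif_neg fun h => h.2 hx
  -- The choice in `f'` is harmless: interior points have one preimage, and on the boundary `F` was
  -- made to agree with `f`.
  have hf'Q : ∀ i p, f' (Q i p) = F i p := by
    rintro i ⟨a, v⟩
    by_cases hv : (v : EuclideanSpace ℝ (Fin n)) ∈ Metric.sphere 0 1
    · rw [hf'A (hQA i a v hv), hFe i a v hv]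
    · have hv' : (v : EuclideanSpace ℝ (Fin n)) ∈ Metric.ball 0 1 := by
        have := v.2
        simp only [mem_closedBall_zero_iff, mem_sphere_zero_iff_norm, mem_ball_zero_iff] at this hv ⊢
        exact lt_of_le_of_ne this hv
      have hm := hbij.mapsTo (x := ⟨i, (a, v)⟩) hv'
      have hx : (Q i (a, v) : X) ∈ B ∧ (Q i (a, v) : X) ∉ A := hm
      have hc := (hpre _ hx.1 hx.2).choose_spec
      have := hbij.injOn (x₂ := ⟨i, (a, v)⟩) hc.1 hv' hc.2
      simp only [f']
      rw [dif_pos hx, this]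
  refine ⟨f', ?_, fun g x hx => ?_, hf'A⟩
  · rw [continuousOn_iff_continuous_domRestrict, hquot.continuous_iff]
    refine continuous_sum_dom.2 ⟨?_, ?_⟩
    · convert continuousOn_iff_continuous_domRestrict.1 hf using 1
      funext x
      exact hf'A x.2
    · have hF' : Continuous fun p : Σ i, (G ⧸ H i) × unitDisk n => F p.1 p.2 :=
        continuous_sigma hF
      convert hF' using 1
      funext p
      exact hf'Q p.1 p.2
  · by_cases hxA : x ∈ A
    · rw [hf'A ((hA' g x).2 hxA), hf'A hxA, hfG g x hxA]
    · obtain ⟨⟨i, a, v⟩, -, rfl⟩ := hpre x hx hxA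
      rw [← hQG, hf'Q, hf'Q, hFG]

/-- Cell-by-cell construction of a `G`-map out of a `G`-CW-complex. -/
theorem IsGCWComplex.nonempty_gMap {X T : Type u} [TopologicalSpace X] [MulAction G X]
    [TopologicalSpace T] [MulAction G T] (hX : IsGCWComplex G X)
    (hT : ∀ H : Subgroup G, (∃ x : X, MulAction.stabilizer G x = H) →
      ∀ (Y : Type) [TopologicalSpace Y] [T2Space Y],
      HasUniqueGMap G ((G ⧸ H) × TrivialGSpace G Y) T) : Nonempty (GMap G X T) := by
  obtain ⟨sk, h0, hmono, hG, hun, htop, hatt⟩ := hX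
  rcases isEmpty_or_nonempty X with hX | ⟨⟨x₀⟩⟩
  · exact ⟨{ toFun := isEmptyElim, continuous_toFun := by fun_prop, map_smul' := fun _ x => isEmptyElim x }⟩
  obtain ⟨⟨c⟩, -⟩ := hT _ ⟨x₀, rfl⟩ Unit
  let P : ℕ → (X → T) → Prop := fun n f =>
    ContinuousOn f (sk n) ∧ ∀ (g : G), ∀ x ∈ sk n, f (g • x) = g • f x
  have step : ∀ n (f : {f // P n f}), ∃ f' : {f // P (n + 1) f}, Set.EqOn f'.1 f.1 (sk n) :=
    fun n f => by
      obtain ⟨f', h1, h2, h3⟩ := (hatt n).exists_extension hT (hG n) f.1 f.2.1 f.2.2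
      exact ⟨⟨f', h1, h2⟩, h3⟩
  choose e he using step
  -- As `sk 0 = ∅`, any function can start the recursion; `c` only supplies a point of `T`.
  let s : ∀ n, {f // P n f} := fun n => Nat.rec
    ⟨fun _ => c.toFun ((1 : G), ULift.up ()), by simp [P, h0]⟩ (fun n f => e n f) n
  have hs : ∀ m n, m ≤ n → Set.EqOn (s n).1 (s m).1 (sk m) := by
    intro m n hmn
    induction n, hmn using Nat.le_induction with
    | base => exact fun _ _ => rfl
    | succ n hmn ih => exact fun x hx => (he n (s n) (hmono hmn hx)).trans (ih hx)
  have hN : ∀ x, ∃ n, x ∈ sk n := fun x => Set.mem_iUnion.1 (hun ▸ Set.mem_univ x)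
  choose N hN using hN
  let f : X → T := fun x => (s (N x)).1 x
  have hf : ∀ n, Set.EqOn f (s n).1 (sk n) := fun n x hx => by
    rcases le_total n (N x) with h | h
    · exact hs _ _ h hx
    · exact (hs _ _ h (hN x)).symm
  refine ⟨{ toFun := f, continuous_toFun := ?_, map_smul' := fun g x => ?_ }⟩
  · refine continuous_iff_isClosed.2 fun C hC => (htop _).2 fun n => ?_
    exact hC.preimage (continuousOn_iff_continuous_domRestrict.1 ((s n).2.1.congr (hf n)))
  · rw [hf (N x) (hG _ g x (hN x)), (s (N x)).2.2 g x (hN x)]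

end Extension

/-! ### The rainbow complex and its weak topology. -/

/-- The convex combinations of finitely many vertices in `∐ G/K i`, at most one in each orbit. -/
def rainbowPoints {G : Type u} [Group G] {ι : Type u} (K : ι → Subgroup G) :
    Set ((Σ i, G ⧸ K i) → ℝ) :=
  {f | (∀ v, 0 ≤ f v) ∧ ∃ s : Finset (Σ i, G ⧸ K i), Set.InjOn Sigma.fst (s : Set (Σ i, G ⧸ K i)) ∧
    (∀ v ∉ s, f v = 0) ∧ ∑ v ∈ s, f v = 1}

/-- The simplicial complex whose simplices are the finite sets of vertices in `∐ G/K i` with at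
most one vertex in each orbit. -/
@[ext]
structure RainbowComplex {G : Type u} [Group G] {ι : Type u} (K : ι → Subgroup G) : Type u where
  weight : (Σ i, G ⧸ K i) → ℝ
  mem : weight ∈ rainbowPoints K

namespace RainbowComplex

open scoped Pointwise Classical

section Basic

variable {G : Type u} [Group G] {ι : Type u} {K : ι → Subgroup G}

theorem finite_support (z : RainbowComplex K) : (Function.support z.weight).Finite := by
  obtain ⟨-, s, -, h, -⟩ := z.mem
  exact s.finite_toSet.subset fun v hv => by_contra fun hs => hv (h v hs)

/-- The vertices of the smallest simplex containing `z`. -/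
noncomputable def supp (z : RainbowComplex K) : Finset (Σ i, G ⧸ K i) := z.finite_support.toFinset

theorem mem_supp {z : RainbowComplex K} {v : Σ i, G ⧸ K i} : v ∈ z.supp ↔ z.weight v ≠ 0 := by
  simp [supp]

theorem weight_eq_zero {z : RainbowComplex K} {v : Σ i, G ⧸ K i} (h : v ∉ z.supp) :
    z.weight v = 0 := by
  simpa [mem_supp] using h

theorem supp_subset_iff {z : RainbowComplex K} {s : Finset (Σ i, G ⧸ K i)} :
    z.supp ⊆ s ↔ ∀ v ∉ s, z.weight v = 0 :=
  ⟨fun h _ hv => weight_eq_zero fun h' => hv (h h'),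
    fun h v hv => by_contra fun hs => mem_supp.1 hv (h v hs)⟩

theorem injOn_supp (z : RainbowComplex K) :
    Set.InjOn Sigma.fst (z.supp : Set (Σ i, G ⧸ K i)) := by
  obtain ⟨-, s, hs, h, -⟩ := z.mem
  exact hs.mono (Finset.coe_subset.2 (supp_subset_iff.2 h))

theorem sum_of_supp_subset (z : RainbowComplex K) {s : Finset (Σ i, G ⧸ K i)} (hs : z.supp ⊆ s) :
    ∑ v ∈ s, z.weight v = 1 := by
  obtain ⟨-, t, -, h, h1⟩ := z.mem
  rw [← Finset.sum_subset hs fun v _ hv => weight_eq_zero hv, ← h1]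
  exact Finset.sum_subset (supp_subset_iff.2 h) fun v _ hv => weight_eq_zero hv

theorem supp_nonempty (z : RainbowComplex K) : z.supp.Nonempty := by
  by_contra h
  simpa [Finset.not_nonempty_iff_eq_empty.1 h] using z.sum_of_supp_subset subset_rfl

/-- The faces, as sets of functions. -/
def faceSet (K : ι → Subgroup G) (s : Finset (Σ i, G ⧸ K i)) : Set ((Σ i, G ⧸ K i) → ℝ) :=
  {f | f ∈ rainbowPoints K ∧ ∀ v ∉ s, f v = 0}

/-- The inclusion of a face. -/
def ofFace (p : Σ s : Finset (Σ i, G ⧸ K i), faceSet K s) : RainbowComplex K := ⟨p.2.1, p.2.2.1⟩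

theorem ofFace_surjective : Function.Surjective (ofFace (K := K)) := fun z =>
  ⟨⟨z.supp, z.weight, z.mem, fun _ => weight_eq_zero⟩, rfl⟩

/-- The weak topology with respect to the faces. -/
instance : TopologicalSpace (RainbowComplex K) := .coinduced ofFace inferInstance

theorem isQuotientMap_ofFace : Topology.IsQuotientMap (ofFace (K := K)) :=
  ⟨⟨rfl⟩, ofFace_surjective⟩

theorem continuous_weight : Continuous (weight (K := K)) :=
  isQuotientMap_ofFace.continuous_iff.2 (continuous_sigma fun _ => continuous_subtype_val)

instance : T2Space (RainbowComplex K) :=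
  .of_injective_continuous (fun _ _ h => RainbowComplex.ext h) continuous_weight

/-- Coordinatewise continuity is too weak for the weak topology in general, but suffices on one
face, which carries the product topology. -/
theorem continuous_of_locally_mem_face {Y : Type*} [TopologicalSpace Y] {f : Y → RainbowComplex K}
    (hw : ∀ v, Continuous fun y => (f y).weight v)
    (hf : ∀ y₀, ∃ s, ∀ᶠ y in nhds y₀, (f y).supp ⊆ s) : Continuous f := by
  refine continuous_iff_continuousAt.2 fun y₀ => ?_
  obtain ⟨s, hs⟩ := hf y₀
  let N : Set Y := {y | (f y).supp ⊆ s}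
  have hN : ContinuousOn f N := by
    refine continuousOn_iff_continuous_domRestrict.2 ?_
    have h : Continuous fun y : N =>
        (⟨(f y).weight, (f y).mem, supp_subset_iff.1 y.2⟩ : faceSet K s) :=
      (continuous_pi fun v => (hw v).comp continuous_subtype_val).subtype_mk _
    exact isQuotientMap_ofFace.continuous.comp (continuous_sigmaMk.comp h)
  exact hN.continuousAt hs

/-- The faces. -/
def face (K : ι → Subgroup G) (s : Finset (Σ i, G ⧸ K i)) : Set (RainbowComplex K) :=
  {z | z.supp ⊆ s}

theorem isClosed_face (s : Finset (Σ i, G ⧸ K i)) : IsClosed (face K s) := by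
  have : face K s = ⋂ v ∈ (sᶜ : Set (Σ i, G ⧸ K i)), {z | z.weight v = 0} := by
    ext z; simp [face, supp_subset_iff]
  rw [this]
  exact isClosed_biInter fun v _ =>
    isClosed_eq ((continuous_apply v).comp continuous_weight) continuous_const

/-- Within a face, `C` is the finite union of its intersections with the subfaces that are supports
of points of `C`, so only these need testing. -/
theorem isClosed_of_inter_face {C : Set (RainbowComplex K)}
    (hC : ∀ z ∈ C, IsClosed (C ∩ face K z.supp)) : IsClosed C := by
  rw [← isQuotientMap_ofFace.isClosed_preimage, isClosed_sigma_iff]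
  intro s
  have hU : IsClosed (⋃ t ∈ {t | t ⊆ s ∧ ∃ z ∈ C, z.supp = t}, C ∩ face K t) := by
    refine Set.Finite.isClosed_biUnion (s.powerset.finite_toSet.subset fun t ht => ?_) ?_
    · exact Finset.mem_coe.2 (Finset.mem_powerset.2 ht.1)
    · rintro t ⟨-, z, hz, rfl⟩
      exact hC z hz
  convert hU.preimage (isQuotientMap_ofFace.continuous.comp (continuous_sigmaMk (i := s))) using 1
  ext f
  refine ⟨fun h => ?_, fun h => ?_⟩
  · exact Set.mem_biUnion (x := (ofFace ⟨s, f⟩).supp)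
      ⟨supp_subset_iff.2 f.2.2, _, h, rfl⟩ ⟨h, Finset.Subset.refl _⟩
  · obtain ⟨_, _, h⟩ := Set.mem_iUnion₂.1 h
    exact h.1

/-- The points on simplices with at most `n` vertices. -/
def skeleton (K : ι → Subgroup G) (n : ℕ) : Set (RainbowComplex K) := {z | z.supp.card ≤ n}

theorem skeleton_subset_succ (n : ℕ) : skeleton K n ⊆ skeleton K (n + 1) :=
  fun _ hz => Nat.le_succ_of_le hz

theorem face_subset_skeleton {s : Finset (Σ i, G ⧸ K i)} {n : ℕ} (h : s.card ≤ n) :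
    face K s ⊆ skeleton K n := fun _ hz => (Finset.card_le_card hz).trans h

theorem isClosed_skeleton (n : ℕ) : IsClosed (skeleton K n) :=
  isClosed_of_inter_face fun _ hz => by
    rw [Set.inter_eq_right.2 (face_subset_skeleton hz)]
    exact isClosed_face _

/-- Characteristic maps of the simplices. -/
theorem exists_disk_parametrization {n : ℕ} {s : Finset (Σ i, G ⧸ K i)}
    (hs : Set.InjOn Sigma.fst (s : Set (Σ i, G ⧸ K i))) (hn : s.card = n + 1) :
    ∃ σ : unitDisk n → RainbowComplex K, Continuous σ ∧ Function.Injective σ ∧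
      Set.range σ = face K s ∧
      ∀ v : unitDisk n, (v : EuclideanSpace ℝ (Fin n)) ∈ Metric.ball 0 1 ↔ (σ v).supp = s := by
  -- The `n + 1` vertices are realized as an affine basis of `ℝⁿ`. Their hull is a convex body,
  -- carried to the unit ball by a homeomorphism; its interior is where all barycentric coordinates
  -- are positive.
  obtain ⟨b⟩ : Nonempty (AffineBasis s ℝ (EuclideanSpace ℝ (Fin n))) :=
    AffineBasis.exists_affineBasis_of_finiteDimensional (k := ℝ)
      (P := EuclideanSpace ℝ (Fin n)) (by simp [hn])
  let S := convexHull ℝ (Set.range b)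
  have hSc : IsCompact S := Set.Finite.isCompact_convexHull (𝕜 := ℝ) (Set.finite_range b)
  have hSi : interior S = {x | ∀ i, 0 < b.coord i x} := b.interior_convexHull
  have hSn : S = {x | ∀ i, 0 ≤ b.coord i x} := b.convexHull_eq_nonneg_coord
  obtain ⟨h, hi, hc, -⟩ := exists_homeomorph_image_interior_closure_frontier_eq_unitBall
    (convex_convexHull ℝ (Set.range b)) ⟨_, AffineBasis.centroid_mem_interior_convexHull b⟩ hSc.isBounded
  rw [hSc.isClosed.closure_eq] at hc
  have hball : ∀ v, v ∈ Metric.ball 0 1 ↔ ∀ i, 0 < b.coord i (h.symm v) := fun v => by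
    rw [← hi, show interior ((convexHull ℝ) (Set.range b)) = _ from hSi, h.image_eq_preimage_symm]
    rfl
  have hdisk : ∀ v, v ∈ Metric.closedBall 0 1 ↔ ∀ i, 0 ≤ b.coord i (h.symm v) := fun v => by
    rw [← hc, hSn, h.image_eq_preimage_symm]
    rfl
  let w : EuclideanSpace ℝ (Fin n) → (Σ i, G ⧸ K i) → ℝ := fun x u =>
    if hu : u ∈ s then b.coord ⟨u, hu⟩ x else 0
  have hw : ∀ x (u : s), w x u = b.coord u x := fun x u => dif_pos u.2
  have hw0 : ∀ x, ∀ u ∉ s, w x u = 0 := fun x u hu => dif_neg hu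
  let σ : unitDisk n → RainbowComplex K := fun v => ⟨w (h.symm v), by
    refine ⟨fun u => ?_, s, hs, hw0 _, ?_⟩
    · by_cases hu : u ∈ s
      · exact (hw _ ⟨u, hu⟩).symm ▸ (hdisk v).1 v.2 ⟨u, hu⟩
      · exact (hw0 _ u hu).ge
    · rw [← Finset.sum_coe_sort, ← b.sum_coord_apply_eq_one (h.symm v)]
      exact Finset.sum_congr rfl fun u _ => hw _ u⟩
  have hσs : ∀ v, (σ v).supp ⊆ s := fun v => supp_subset_iff.2 (hw0 _)
  refine ⟨σ, ?_, ?_, ?_, fun v => ?_⟩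
  · refine continuous_of_locally_mem_face (fun u => ?_)
      fun y₀ => ⟨s, Filter.Eventually.of_forall hσs⟩
    by_cases hu : u ∈ s
    · simp only [σ, w, dif_pos hu]
      exact (continuous_barycentric_coord b ⟨u, hu⟩).comp
        (h.symm.continuous.comp continuous_subtype_val)
    · simp only [σ, w, dif_neg hu]
      exact continuous_const
  · intro v v' hv
    refine Subtype.ext (h.symm.injective (b.ext_elem fun u => ?_))
    rw [← hw, ← hw]
    exact congrFun (congrArg weight hv) u
  · refine Set.Subset.antisymm (Set.range_subset_iff.2 hσs) fun z hz => ?_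
    have hsum : ∑ u : s, z.weight u = 1 := by
      rw [Finset.sum_coe_sort]
      exact z.sum_of_supp_subset hz
    let x := Finset.univ.affineCombination ℝ b fun u : s => z.weight u
    have hx : ∀ u : s, b.coord u x = z.weight u := fun u =>
      b.coord_apply_combination_of_mem (Finset.mem_univ u) hsum
    refine ⟨⟨h x, (hdisk _).2 fun u => ?_⟩, ?_⟩
    · rw [h.symm_apply_apply, hx]
      exact z.mem.1 u
    · ext u
      by_cases hu : u ∈ s
      · simp only [σ, h.symm_apply_apply]
        exact (hw x ⟨u, hu⟩).trans (hx ⟨u, hu⟩)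
      · exact (hw0 _ u hu).trans (supp_subset_iff.1 hz u hu).symm
  · rw [hball]
    constructor
    · refine fun hv => (hσs v).antisymm fun u hu => mem_supp.2 ?_
      exact ((hw (h.symm v) ⟨u, hu⟩).trans_ne (hv ⟨u, hu⟩).ne')
    · intro hv u
      have h1 : (σ v).weight u ≠ 0 := mem_supp.1 (hv.symm ▸ u.2)
      have h2 := (σ v).mem.1 u
      have h3 : (σ v).weight u = b.coord u (h.symm v) := hw _ u
      rw [← h3]
      exact lt_of_le_of_ne h2 h1.symm

end Basic

end RainbowComplex

/-! ### The action on the rainbow complex. -/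

namespace RainbowComplex

open scoped Pointwise Classical

section Action

variable {G : Type u} [Group G] {ι : Type u} {K : ι → Subgroup G}

theorem smul_weight_mem (g : G) {f : (Σ i, G ⧸ K i) → ℝ} (hf : f ∈ rainbowPoints K) :
    (fun v => f (g⁻¹ • v)) ∈ rainbowPoints K := by
  obtain ⟨h0, s, hs, hs0, h1⟩ := hf
  refine ⟨fun v => h0 _, g • s, ?_, fun v hv => hs0 _ fun h => hv ?_, ?_⟩
  · intro v hv w hw h
    have hv' : g⁻¹ • v ∈ s := Finset.inv_smul_mem_iff.2 hv
    have hw' : g⁻¹ • w ∈ s := Finset.inv_smul_mem_iff.2 hw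
    exact smul_left_cancel g⁻¹ (hs hv' hw' h)
  · exact Finset.inv_smul_mem_iff.1 h
  · rw [← h1, Finset.smul_finset_def, Finset.sum_image fun _ _ _ _ h => smul_left_cancel g h]
    simp

noncomputable instance : MulAction G (RainbowComplex K) where
  smul g z := ⟨fun v => z.weight (g⁻¹ • v), smul_weight_mem g z.mem⟩
  one_smul z := RainbowComplex.ext (funext fun v => by
    change z.weight ((1 : G)⁻¹ • v) = _; simp)
  mul_smul g h z := RainbowComplex.ext (funext fun v => by
    change z.weight ((g * h)⁻¹ • v) = z.weight (h⁻¹ • g⁻¹ • v); rw [mul_inv_rev, mul_smul])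

theorem weight_smul (g : G) (z : RainbowComplex K) (v : Σ i, G ⧸ K i) :
    (g • z).weight v = z.weight (g⁻¹ • v) := rfl

theorem supp_smul (g : G) (z : RainbowComplex K) : (g • z).supp = g • z.supp := by
  ext v
  rw [mem_supp, weight_smul, ← Finset.inv_smul_mem_iff, mem_supp]

/-- A group element that preserves a rainbow set of vertices fixes all of them. -/
theorem smul_eq_of_smul_finset_eq {s : Finset (Σ i, G ⧸ K i)}
    (hs : Set.InjOn Sigma.fst (s : Set (Σ i, G ⧸ K i))) {g : G} (hg : g • s = s)
    {v : Σ i, G ⧸ K i} (hv : v ∈ s) : g • v = v := by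
  have h : g • v ∈ s := hg ▸ Finset.smul_mem_smul_finset hv
  exact hs h hv rfl

theorem smul_eq_of_fixes_supp {g : G} {z : RainbowComplex K} (h : ∀ v ∈ z.supp, g • v = v) :
    g • z = z := by
  ext v
  rw [weight_smul]
  by_cases hv : v ∈ z.supp
  · rw [inv_smul_eq_iff.2 (h v hv).symm]
  · rw [weight_eq_zero hv, weight_eq_zero]
    intro hv'
    have := h _ hv'
    rw [smul_inv_smul] at this
    exact hv (this ▸ hv')

theorem smul_eq_iff_fixes_supp {g : G} {z : RainbowComplex K} :
    g • z = z ↔ ∀ v ∈ z.supp, g • v = v :=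
  ⟨fun h _ hv => smul_eq_of_smul_finset_eq z.injOn_supp (by rw [← supp_smul, h]) hv,
    smul_eq_of_fixes_supp⟩

theorem smul_mem_skeleton {n : ℕ} (g : G) {z : RainbowComplex K} (hz : z ∈ skeleton K n) :
    g • z ∈ skeleton K n := by
  simpa [skeleton, supp_smul] using hz

end Action

/-! ### Continuity of the action, isotropy and the `G`-CW-structure. -/

section Topology

variable {G : Type u} [Group G] [TopologicalSpace G] [IsTopologicalGroup G] {ι : Type u}
  {K : ι → Subgroup G}

theorem isOpen_setOf_smul_eq (hK : ∀ i, IsOpen (K i : Set G)) (v w : Σ i, G ⧸ K i) :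
    IsOpen {g : G | g • v = w} := by
  have := fun i => QuotientGroup.discreteTopology (hK i)
  obtain ⟨i, a⟩ := v
  obtain ⟨j, b⟩ := w
  by_cases h : i = j
  · subst h
    have : {g : G | g • (⟨i, a⟩ : Σ i, G ⧸ K i) = ⟨i, b⟩} = (fun g : G => g • a) ⁻¹' {b} := by
      ext g; simp [Sigma.smul_mk]
    rw [this]
    exact (isOpen_discrete {b}).preimage (by fun_prop)
  · convert isOpen_empty
    ext g
    simp [Sigma.smul_mk, h]

/-- Local compactness of `G` allows testing on `G × ∐ faces`. Near `g₀` all `g` move the finitely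
many vertices of `s` as `g₀` does, so the image stays in the face of `g₀ • s`. -/
theorem continuousSMul [LocallyCompactSpace G] (hK : ∀ i, IsOpen (K i : Set G)) :
    ContinuousSMul G (RainbowComplex K) := by
  refine ⟨isQuotientMap_ofFace.continuous_lift_prod_right ?_⟩
  refine continuous_of_locally_mem_face (fun v => ?_) fun ⟨g₀, s, f₀⟩ =>
    ⟨g₀ • s, ?_⟩
  · refine continuous_iff_continuousAt.2 fun ⟨g₀, p₀⟩ => ?_
    have h1 : ∀ᶠ q : G × (Σ s, faceSet K s) in nhds (g₀, p₀), q.1⁻¹ • v = g₀⁻¹ • v :=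
      ((continuous_inv.comp continuous_fst).tendsto (g₀, p₀)).eventually
        ((isOpen_setOf_smul_eq hK v _).mem_nhds rfl)
    have h2 : Continuous fun q : G × (Σ s, faceSet K s) => (ofFace q.2).weight (g₀⁻¹ • v) :=
      (continuous_apply _).comp (continuous_weight.comp
        (isQuotientMap_ofFace.continuous.comp continuous_snd))
    refine h2.continuousAt.congr ?_
    filter_upwards [h1] with q hq
    rw [weight_smul, hq]
  · have h1 : ∀ᶠ q : G × (Σ s, faceSet K s) in nhds (g₀, ⟨s, f₀⟩), q.2.1 = s := by
      have : IsOpen (Set.range fun f : faceSet K s => (⟨s, f⟩ : Σ s, faceSet K s)) :=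
        isOpen_range_sigmaMk
      filter_upwards [continuous_snd.continuousAt (this.mem_nhds ⟨f₀, rfl⟩)] with q hq
      obtain ⟨f, hf⟩ := hq
      rw [← hf]
    have h2 : ∀ᶠ q : G × (Σ s, faceSet K s) in nhds (g₀, ⟨s, f₀⟩),
        ∀ v ∈ s, q.1 • v = g₀ • v :=
      (Filter.eventually_all_finset s).2 fun v _ =>
        (continuous_fst.tendsto _).eventually ((isOpen_setOf_smul_eq hK v _).mem_nhds rfl)
    filter_upwards [h1, h2] with ⟨g, t, f⟩ h1 h2
    obtain rfl : t = s := h1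
    rw [supp_smul]
    have h3 : (ofFace ⟨t, f⟩).supp ⊆ t := supp_subset_iff.2 f.2.2
    have h4 : g • t = g₀ • t := Finset.image_congr h2
    rw [← h4]
    exact Finset.smul_finset_subset_smul_finset h3

theorem isCompact_stabilizer_vertex (hK : ∀ i, IsCompact (K i : Set G)) (v : Σ i, G ⧸ K i) :
    IsCompact (MulAction.stabilizer G v : Set G) := by
  obtain ⟨i, a⟩ := v
  induction a using QuotientGroup.induction_on with
  | H a =>
    convert (hK i).image (f := fun k => a * k * a⁻¹) (by fun_prop)
    ext g
    simp only [SetLike.mem_coe, MulAction.mem_stabilizer_iff, Sigma.smul_mk, Sigma.mk.injEq,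
      heq_eq_eq, true_and, Set.mem_image, MulAction.Quotient.smul_coe, smul_eq_mul]
    rw [eq_comm, QuotientGroup.eq]
    refine ⟨fun h => ⟨_, h, by group⟩, ?_⟩
    rintro ⟨k, hk, rfl⟩
    simpa [mul_assoc] using hk

/-- The stabilizer is a finite intersection of open vertex stabilizers, and closed in a compact one.
-/
theorem stabilizer_mem_compactOpenSubgroups (hK : ∀ i, K i ∈ compactOpenSubgroups G)
    (z : RainbowComplex K) : MulAction.stabilizer G z ∈ compactOpenSubgroups G := by
  have hset : (MulAction.stabilizer G z : Set G) = ⋂ v ∈ z.supp, {g : G | g • v = v} := by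
    ext g
    simp [smul_eq_iff_fixes_supp]
  have ho : IsOpen (MulAction.stabilizer G z : Set G) := by
    rw [hset]
    exact isOpen_biInter_finset fun v _ => isOpen_setOf_smul_eq (fun i => (hK i).2) v v
  obtain ⟨v, hv⟩ := z.supp_nonempty
  refine ⟨(isCompact_stabilizer_vertex (fun i => (hK i).1) v).of_isClosed_subset
    (Subgroup.isClosed_of_isOpen _ ho) ?_, ho⟩
  rw [hset]
  exact Set.biInter_subset_of_mem (t := fun v => {g : G | g • v = v}) hv

/-- The cells are the `G`-orbits of `n`-simplices. The rainbow condition makes the setwise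
stabilizer of a simplex fix it pointwise, so no subdivision is needed; this stabilizer is open, so
`G ⧸ H s` is discrete. -/
theorem attachesGCells [LocallyCompactSpace G] (hK : ∀ i, IsOpen (K i : Set G)) (n : ℕ) :
    AttachesGCells G n (skeleton K n) (skeleton K (n + 1)) := by
  have := continuousSMul hK
  -- One simplex is selected in each orbit; `rep s = s` singles out the selected ones.
  let rep : Finset (Σ i, G ⧸ K i) → Finset (Σ i, G ⧸ K i) := fun s =>
    (Quotient.mk (MulAction.orbitRel G (Finset (Σ i, G ⧸ K i))) s).out
  have hrep : ∀ s, ∃ g : G, g • rep s = s := fun s => by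
    have : (MulAction.orbitRel G (Finset (Σ i, G ⧸ K i))) s (rep s) :=
      Quotient.exact (Quotient.out_eq _).symm
    exact MulAction.orbitRel_apply.1 this
  have hrep' : ∀ (g : G) s, rep (g • s) = rep s := fun g s =>
    congrArg Quotient.out (Quotient.sound (MulAction.orbitRel_apply.2 ⟨g, rfl⟩))
  let I := {s : Finset (Σ i, G ⧸ K i) // Set.InjOn Sigma.fst (s : Set (Σ i, G ⧸ K i)) ∧
    s.card = n + 1 ∧ rep s = s}
  have hI : ∀ z : RainbowComplex K, z.supp.card = n + 1 → ∃ (s : I) (g : G), z.supp = g • s.1 := by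
    intro z hz
    obtain ⟨g, hg⟩ := hrep z.supp
    have hg' : rep z.supp = g⁻¹ • z.supp := eq_inv_smul_iff.2 hg
    refine ⟨⟨rep z.supp, ?_, ?_, ?_⟩, g, hg.symm⟩
    · rw [hg', ← supp_smul]
      exact injOn_supp _
    · rw [hg', Finset.card_smul_finset, hz]
    · rw [hg', hrep', hg']
  choose σ hσ hσi hσr hσb using fun s : I => exists_disk_parametrization s.2.1 s.2.2.1
  let H : I → Subgroup G := fun s => ⨅ v ∈ s.1, MulAction.stabilizer G v
  have hH : ∀ (s : I) (g : G), g ∈ H s ↔ ∀ v ∈ s.1, g • v = v := fun s g => by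
    simp [H, Subgroup.mem_iInf]
  have hHo : ∀ s, IsOpen (H s : Set G) := fun s => by
    have : (H s : Set G) = ⋂ v ∈ s.1, {g : G | g • v = v} := by
      ext g; simp [hH]
    rw [this]
    exact isOpen_biInter_finset fun v _ => isOpen_setOf_smul_eq hK v v
  have := fun s => QuotientGroup.discreteTopology (hHo s)
  have hσs : ∀ s v, (σ s v).supp ⊆ s.1 := fun s v =>
    (hσr s).le (Set.mem_range_self v)
  have hHσ : ∀ s, ∀ g ∈ H s, ∀ v, g • σ s v = σ s v := fun s g hg v =>
    smul_eq_of_fixes_supp fun u hu => (hH s g).1 hg u (hσs s v hu)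
  have hmem : ∀ s (g : G) v, g • σ s v ∈ skeleton K (n + 1) := fun s g v =>
    smul_mem_skeleton g (face_subset_skeleton s.2.2.1.le (hσs s v))
  let Q : ∀ s, (G ⧸ H s) × unitDisk n → skeleton K (n + 1) := fun s p =>
    ⟨p.1.out • σ s p.2, hmem s _ _⟩
  have hQ : ∀ s (g : G) v, (Q s (g, v) : RainbowComplex K) = g • σ s v := by
    intro s g v
    obtain ⟨h, hh⟩ := QuotientGroup.mk_out_eq_mul (H s) g
    simp only [Q]
    rw [hh, mul_smul, hHσ s h h.2]
  have hQc : ∀ s, Continuous (Q s) := fun s =>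
    (continuous_prod_of_discrete_left.2 fun a => ((hσ s).const_smul a.out)).subtype_mk _
  have hQsupp : ∀ s a (v : unitDisk n), (v : EuclideanSpace ℝ (Fin n)) ∈ Metric.ball 0 1 →
      (Q s (a, v) : RainbowComplex K).supp = a.out • s.1 := fun s a v hv => by
    simp only [Q, supp_smul, (hσb s v).1 hv]
  have hclosed : ∀ C : Set (skeleton K (n + 1)),
      IsClosed ((Sum.elim (Set.inclusion (skeleton_subset_succ n))
        fun p : Σ s, (G ⧸ H s) × unitDisk n => Q p.1 p.2) ⁻¹' C) → IsClosed C := by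
    intro C hC
    obtain ⟨hC1, hC2⟩ := isClosed_sum_iff.1 hC
    have hC3 := isClosed_sigma_iff.1 hC2
    suffices h : IsClosed ((↑) '' C : Set (RainbowComplex K)) by
      convert h.preimage (continuous_subtype_val (p := (· ∈ skeleton K (n + 1))))
      exact (Set.preimage_image_eq _ Subtype.val_injective).symm
    refine isClosed_of_inter_face ?_
    rintro _ ⟨⟨z, hz⟩, hzC, rfl⟩
    -- A top-dimensional face meets `C` in the image of a compact subset of the disk; a lower face
    -- lies in `skeleton K n`, where `C` is closed by `hC1`.
    rcases Nat.lt_or_ge n z.supp.card with hn | hn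
    · obtain ⟨s, g, hg⟩ := hI z (le_antisymm hz hn)
      have hcl : IsClosed {v | Q s (g, v) ∈ C} :=
        (hC3 s).preimage (continuous_const.prodMk continuous_id)
      convert (hcl.isCompact.image ((hσ s).const_smul g)).isClosed
      ext x
      simp only [Set.mem_inter_iff, Set.mem_image, Set.mem_ofPred_eq, face]
      constructor
      · rintro ⟨⟨y, hy, rfl⟩, hx⟩
        obtain ⟨v, hv⟩ : g⁻¹ • (y : RainbowComplex K) ∈ Set.range (σ s) := by
          rw [hσr]
          change (g⁻¹ • (y : RainbowComplex K)).supp ⊆ _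
          rw [supp_smul]
          rw [hg] at hx
          simpa using Finset.smul_finset_subset_smul_finset (a := g⁻¹) hx
        have hyv : g • σ s v = y := by rw [hv, smul_inv_smul]
        refine ⟨v, ?_, hyv⟩
        rwa [show Q s (g, v) = y from Subtype.ext ((hQ s g v).trans hyv)]
      · rintro ⟨v, hv, rfl⟩
        refine ⟨⟨_, hv, hQ s g v⟩, ?_⟩
        simp only [Pi.smul_apply]
        rw [supp_smul, hg]
        exact Finset.smul_finset_subset_smul_finset (hσs s v)
    · have h1 := (isClosed_skeleton n).isClosedMap_subtype_val _ hC1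
      convert h1.inter (isClosed_face z.supp) using 1
      ext x
      refine and_congr_left fun hx => ?_
      have hx' := face_subset_skeleton hn hx
      refine ⟨fun ⟨y, hy, e⟩ => ⟨⟨x, hx'⟩, ?_, rfl⟩, fun ⟨y, hy, e⟩ => ⟨_, hy, e⟩⟩
      subst e
      exact hy
  have hbij : Set.BijOn (fun p : Σ s, (G ⧸ H s) × unitDisk n => (Q p.1 p.2 : RainbowComplex K))
      {p | (p.2.2 : EuclideanSpace ℝ (Fin n)) ∈ Metric.ball 0 1}
      (skeleton K (n + 1) \ skeleton K n) := by
    refine ⟨?_, ?_, ?_⟩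
    · rintro ⟨s, a, v⟩ hv
      refine ⟨(Q s (a, v)).2, ?_⟩
      simp only [skeleton, Set.mem_ofPred_eq]
      rw [hQsupp s a v hv, Finset.card_smul_finset, s.2.2.1]
      omega
    · rintro ⟨s, a, v⟩ hv ⟨s', a', v'⟩ hv' h
      simp only at h
      have hs : a.out • s.1 = a'.out • s'.1 := by
        rw [← hQsupp s a v hv, ← hQsupp s' a' v' hv', h]
      obtain rfl : s = s' := by
        refine Subtype.ext ?_
        rw [← s.2.2.2, ← s'.2.2.2, ← hrep' a.out, hs, hrep']
      have hk : a'.out⁻¹ * a.out ∈ H s := (hH s _).2 fun u hu =>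
        smul_eq_of_smul_finset_eq s.2.1 (by rw [mul_smul, hs, inv_smul_smul]) hu
      obtain rfl : a = a' := by
        rw [← a.out_eq', ← a'.out_eq']
        exact (QuotientGroup.eq.2 hk).symm
      obtain rfl := hσi s (smul_left_cancel _ h)
      rfl
    · rintro z ⟨hz, hz'⟩
      have hz1 : z.supp.card = n + 1 := by
        simp only [skeleton, Set.mem_ofPred_eq] at hz hz'
        omega
      obtain ⟨s, g, hg⟩ := hI z hz1
      have hg' : (g⁻¹ • z).supp = s.1 := by rw [supp_smul, hg, inv_smul_smul]
      obtain ⟨v, hv⟩ : g⁻¹ • z ∈ Set.range (σ s) := by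
        rw [hσr]
        exact hg'.le
      refine ⟨⟨s, g, v⟩, (hσb s v).2 (hv ▸ hg'), ?_⟩
      simp only [hQ, hv, smul_inv_smul]
  refine ⟨skeleton_subset_succ n, I, H, Q, fun s => Subgroup.isClosed_of_isOpen _ (hHo s),
    hQc, fun s g a v => ?_, fun s a v hv => ?_, hbij, ?_⟩
  · induction a using QuotientGroup.induction_on with
    | H a => rw [MulAction.Quotient.smul_coe, hQ, hQ, smul_eq_mul, mul_smul]
  -- A boundary point misses a vertex, so it lies one skeleton lower.
  · have hne : (σ s v).supp ≠ s.1 := fun h => by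
      have := (hσb s v).2 h
      simp only [mem_sphere_zero_iff_norm, mem_ball_zero_iff] at hv this
      exact this.ne hv
    have := Finset.card_lt_card ((hσs s v).ssubset_of_ne hne)
    rw [s.2.2.1] at this
    exact smul_mem_skeleton _ (Nat.lt_succ_iff.1 this)
  · have hcont : Continuous
        (Sum.elim (Set.inclusion (skeleton_subset_succ n))
          fun p : Σ s, (G ⧸ H s) × unitDisk n => Q p.1 p.2) :=
      continuous_sum_dom.2 ⟨continuous_inclusion (skeleton_subset_succ n), continuous_sigma hQc⟩
    refine Topology.isQuotientMap_iff_isClosed.2 ⟨fun z => ?_,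
      fun C => ⟨fun h => h.preimage hcont, hclosed C⟩⟩
    by_cases hz : z.1 ∈ skeleton K n
    · exact ⟨Sum.inl ⟨z, hz⟩, rfl⟩
    · obtain ⟨p, -, hp⟩ := hbij.surjOn ⟨z.2, hz⟩
      exact ⟨Sum.inr p, Subtype.ext hp⟩

/-- Counting vertices instead of dimension gives the index shift of `IsGCWComplex`. -/
theorem isGCWComplex [LocallyCompactSpace G] (hK : ∀ i, IsOpen (K i : Set G)) :
    IsGCWComplex G (RainbowComplex K) := by
  refine ⟨skeleton K, ?_, fun m n h z hz => le_trans hz h, fun n g z hz => smul_mem_skeleton g hz,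
    Set.eq_univ_of_forall fun z => Set.mem_iUnion.2 ⟨_, le_refl z.supp.card⟩, fun C =>
    ⟨fun h n => h.preimage continuous_subtype_val, fun h => isClosed_of_inter_face fun z hz => ?_⟩,
    attachesGCells hK⟩
  · ext z
    simp [skeleton, z.supp_nonempty.ne_empty]
  · have h1 := (isClosed_skeleton _).isClosedMap_subtype_val _ (h z.supp.card)
    rw [Subtype.image_preimage_coe] at h1
    convert h1.inter (isClosed_face z.supp) using 1
    ext x
    exact ⟨fun hx => ⟨⟨face_subset_skeleton le_rfl hx.2, hx.1⟩, hx.2⟩, fun hx => ⟨hx.1.2, hx.2⟩⟩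

end Topology

end RainbowComplex

/-! ### Maps between numerable spaces and `G`-CW-complexes. -/

section Nerve

variable {G : Type u} [Group G] [TopologicalSpace G] [IsTopologicalGroup G]

open scoped Classical in
/-- The `G`-map to the nerve that is defined by a partition of unity. -/
theorem exists_gMap_rainbowComplex {F : Set (Subgroup G)} (hF : ∀ H ∈ F, IsOpen (H : Set G))
    {Y : Type u} [TopologicalSpace Y] [MulAction G Y] (hY : IsNumerableGSpace F Y) :
    ∃ (ι : Type u) (K : ι → Subgroup G), (∀ i, K i ∈ F) ∧
      Nonempty (GMap G Y (RainbowComplex K)) := by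
  obtain ⟨ι, U, K, φ, e, hU, hUG, -, hK, hφ, hφG, he, heG⟩ := hY
  have := fun i => QuotientGroup.discreteTopology (hF _ (hK i))
  -- Openness of `K i` enters here: `G ⧸ K i` is discrete, so `φ i` is locally constant on `U i`.
  have hloc : ∀ i, ∀ y₀ ∈ U i, ∀ᶠ y in nhds y₀, φ i y = φ i y₀ := fun i y₀ hy₀ =>
    ((hφ i).continuousAt ((hU i).mem_nhds hy₀)).eventually
      ((isOpen_discrete {φ i y₀}).mem_nhds rfl)
  have hzero : ∀ i, ∀ y ∉ U i, e i y = 0 := fun i y hy =>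
    image_eq_zero_of_notMem_tsupport fun h => hy (he i h)
  -- The point `y` puts weight `e i y` on the single vertex `φ i y` of the `i`-th orbit. Values of
  -- `φ i` outside `U i` get weight `0`.
  let w : Y → (Σ i, G ⧸ K i) → ℝ := fun y v => if φ v.1 y = v.2 then e v.1 y else 0
  have hw : ∀ (s : Finset ι) y, e.finsupport y ⊆ s →
      ∀ v ∉ s.image fun i => (⟨i, φ i y⟩ : Σ i, G ⧸ K i), w y v = 0 := by
    rintro s y hs ⟨i, a⟩ hv
    by_contra h
    have h1 : φ i y = a := by_contra fun h' => h (if_neg h')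
    have h2 : e i y ≠ 0 := fun h' => h (by simp [w, h'])
    exact hv (Finset.mem_image.2 ⟨i, hs ((e.mem_finsupport y).2 h2), by rw [h1]⟩)
  have hmem : ∀ y, w y ∈ rainbowPoints K := fun y => by
    refine ⟨fun v => ?_, _, ?_, hw _ y subset_rfl, ?_⟩
    · dsimp only [w]
      split_ifs
      exacts [e.nonneg _ _, le_rfl]
    · intro v hv v' hv' h
      obtain ⟨i, -, rfl⟩ := Finset.mem_image.1 (Finset.mem_coe.1 hv)
      obtain ⟨j, -, rfl⟩ := Finset.mem_image.1 (Finset.mem_coe.1 hv')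
      obtain rfl : i = j := h
      rfl
    · rw [Finset.sum_image fun i _ j _ h => congrArg Sigma.fst h]
      simpa [w] using e.sum_finsupport (Set.mem_univ y)
  refine ⟨ι, K, hK, ⟨⟨⟨fun y => ⟨w y, hmem y⟩, ?_⟩,
    fun g y => RainbowComplex.ext (funext fun v => ?_)⟩⟩⟩
  · refine RainbowComplex.continuous_of_locally_mem_face (fun v => ?_) fun y₀ => ?_
    · refine continuous_iff_continuousAt.2 fun y₀ => ?_
      by_cases hy₀ : y₀ ∈ U v.1
      · by_cases hv : φ v.1 y₀ = v.2
        · refine (e v.1).continuous.continuousAt.congr ?_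
          filter_upwards [hloc v.1 y₀ hy₀] with y hy
          simp only [w]
          rw [if_pos (hy.trans hv)]
        · refine (continuousAt_const (y := (0 : ℝ))).congr ?_
          filter_upwards [hloc v.1 y₀ hy₀] with y hy
          simp only [w]
          rw [if_neg (hy.trans_ne hv)]
      · refine (continuousAt_const (y := (0 : ℝ))).congr ?_
        have : (tsupport (e v.1))ᶜ ∈ nhds y₀ :=
          (isClosed_tsupport _).isOpen_compl.mem_nhds fun h => hy₀ (he _ h)
        filter_upwards [this] with y hy
        simp only [w]
        rw [image_eq_zero_of_notMem_tsupport hy, ite_self]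
    · refine ⟨(e.fintsupport y₀).image fun i => ⟨i, φ i y₀⟩, ?_⟩
      have h : ∀ᶠ y in nhds y₀, ∀ i ∈ e.fintsupport y₀, φ i y = φ i y₀ :=
        (Filter.eventually_all_finset _).2 fun i hi =>
          hloc i y₀ (he i ((e.mem_fintsupport_iff y₀ i).1 hi))
      filter_upwards [h, e.eventually_finsupport_subset y₀] with y h1 h2
      rw [RainbowComplex.supp_subset_iff]
      have h3 : ((e.fintsupport y₀).image fun i => (⟨i, φ i y₀⟩ : Σ i, G ⧸ K i)) =
          (e.fintsupport y₀).image fun i => ⟨i, φ i y⟩ :=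
        Finset.image_congr fun i hi => by rw [h1 i hi]
      rw [h3]
      exact hw _ y h2
  · change (if φ v.1 (g • y) = v.2 then e v.1 (g • y) else 0) =
      if φ v.1 y = g⁻¹ • v.2 then e v.1 y else 0
    rw [heG]
    by_cases hy : y ∈ U v.1
    · simp only [hφG _ g y hy, smul_eq_iff_eq_inv_smul]
    · rw [hzero _ y hy, ite_self, ite_self]

/-- A numerable `G`-space with respect to the compact open subgroups maps to the classifying
`G`-CW-complex. -/
theorem IsClassifyingGCW.nonempty_gMap_of_isNumerable [LocallyCompactSpace G]
    {E Y : Type u} [TopologicalSpace E] [MulAction G E] [TopologicalSpace Y] [MulAction G Y]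
    (hE : IsClassifyingGCW (compactOpenSubgroups G) E)
    (hY : IsNumerableGSpace (compactOpenSubgroups G) Y) : Nonempty (GMap G Y E) := by
  obtain ⟨ι, K, hK, ⟨f⟩⟩ := exists_gMap_rainbowComplex (fun H hH => hH.2) hY
  have := RainbowComplex.continuousSMul fun i => (hK i).2
  obtain ⟨⟨k⟩, -⟩ := hE.universal (RainbowComplex K)
    (RainbowComplex.isGCWComplex fun i => (hK i).2)
    (RainbowComplex.stabilizer_mem_compactOpenSubgroups hK)
  exact ⟨k.comp f⟩

/-- Every `G`-CW-complex with compact isotropy groups maps to the classifying numerable space. -/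
theorem IsClassifyingNumerable.nonempty_gMap_of_isGCWComplex [LocallyCompactSpace G] [T2Space G]
    [TotallyDisconnectedSpace G] {J X : Type u} [TopologicalSpace J]
    [MulAction G J] [TopologicalSpace X] [MulAction G X]
    (hJ : IsClassifyingNumerable (compactOpenSubgroups G) J) (hX : IsGCWComplex G X)
    (hc : ∀ x : X, IsCompact (MulAction.stabilizer G x : Set G)) : Nonempty (GMap G X J) := by
  refine hX.nonempty_gMap ?_
  rintro H ⟨x, rfl⟩ Y _ _
  -- Closedness makes the orbit space `G/H` Hausdorff, as the universal property requires.
  have : IsClosed (MulAction.stabilizer G x : Set G) := (hc x).isClosed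
  exact hJ.universal _ (isNumerableGSpace_quotient_prod _ (hc x) _)

end Nerve

/-! ### Assembly of the square. -/

theorem mainTheorem6 {G : Type u} [Group G] [TopologicalSpace G] [IsTopologicalGroup G]
    [LocallyCompactSpace G] [T2Space G] [TotallyDisconnectedSpace G]
    (F : Set (Subgroup G)) (hF : IsSubgroupFamily F)
    (hFop : compactOpenSubgroups G ⊆ F) (hFcom : F ⊆ compactSubgroups G) :
    (∀ H : Subgroup G, IsCompact (H : Set G) → ∃ K ∈ compactOpenSubgroups G, H ≤ K) ∧
    ∀ (E₀ J₀ E J : Type u)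
      [TopologicalSpace E₀] [T2Space E₀] [MulAction G E₀] [ContinuousSMul G E₀]
      [TopologicalSpace J₀] [T2Space J₀] [MulAction G J₀] [ContinuousSMul G J₀]
      [TopologicalSpace E] [T2Space E] [MulAction G E] [ContinuousSMul G E]
      [TopologicalSpace J] [T2Space J] [MulAction G J] [ContinuousSMul G J],
      IsClassifyingGCW (compactOpenSubgroups G) E₀ →
      IsClassifyingNumerable (compactOpenSubgroups G) J₀ →
      IsClassifyingGCW F E →
      IsClassifyingNumerable F J →
      (HasUniqueGMap G E₀ J₀ ∧ HasUniqueGMap G E J ∧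
        HasUniqueGMap G E₀ E ∧ HasUniqueGMap G J₀ J) ∧
      ∀ (u₀ : GMap G E₀ J₀) (u : GMap G E J) (a : GMap G E₀ E) (b : GMap G J₀ J),
        GHomotopic (u.comp a) (b.comp u₀) ∧
        IsGHomotopyEquiv u₀ ∧ IsGHomotopyEquiv u ∧
        IsGHomotopyEquiv a ∧ IsGHomotopyEquiv b := by
  refine ⟨exists_compactOpenSubgroup_ge, ?_⟩
  intro E₀ J₀ E J _ _ _ _ _ _ _ _ _ _ _ _ _ _ _ _ hE₀ hJ₀ hE hJ
  have hle : ∀ H ∈ F, ∃ K ∈ compactOpenSubgroups G, H ≤ K := fun H hH =>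
    exists_compactOpenSubgroup_ge H (hFcom hH)
  have hge : ∀ H ∈ compactOpenSubgroups G, ∃ K ∈ F, H ≤ K := fun H hH => ⟨H, hFop hH, le_rfl⟩
  have nJ₀ := hJ₀.isNumerable
  have nJ := hJ.isNumerable
  obtain ⟨i₀⟩ := hJ₀.nonempty_gMap_of_isGCWComplex hE₀.isGCWComplex fun x => (hE₀.isotropy x).1
  obtain ⟨i⟩ := hJ₀.nonempty_gMap_of_isGCWComplex hE.isGCWComplex fun x => hFcom (hE.isotropy x)
  have nE₀ := nJ₀.comap i₀
  have nE := nJ₀.comap i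
  obtain ⟨r₀⟩ := hE₀.nonempty_gMap_of_isNumerable nJ₀
  -- `E₀` receives a map from `J` directly, and from `E` by way of `J₀` as `r₀.comp i`; these supply
  -- the reverse maps.
  obtain ⟨r⟩ := hE₀.nonempty_gMap_of_isNumerable (nJ.mono_of_le hle)
  have hE₀E := hE.universal E₀ hE₀.isGCWComplex fun x => hFop (hE₀.isotropy x)
  have hE₀E₀ := hE₀.universal E₀ hE₀.isGCWComplex hE₀.isotropy
  have hEE := hE.universal E hE.isGCWComplex hE.isotropy
  have hJ₀J₀ := hJ₀.universal J₀ nJ₀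
  have hJJ := hJ.universal J nJ
  refine ⟨⟨hJ₀.universal E₀ nE₀, hJ.universal E (nE.mono_of_le hge), hE₀E,
    hJ.universal J₀ (nJ₀.mono_of_le hge)⟩, fun u₀ u a b =>
    ⟨(hJ.universal E₀ (nE₀.mono_of_le hge)).2 _ _, ?_, ?_, ?_, ?_⟩⟩
  · exact isGHomotopyEquiv_of_hasUniqueGMap hE₀E₀ hJ₀J₀ ⟨r₀⟩ u₀
  · exact isGHomotopyEquiv_of_hasUniqueGMap hEE hJJ ⟨hE₀E.1.some.comp r⟩ u
  · exact isGHomotopyEquiv_of_hasUniqueGMap hE₀E₀ hEE ⟨r₀.comp i⟩ a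
  · exact isGHomotopyEquiv_of_hasUniqueGMap hJ₀J₀ hJJ (hJ₀.universal J (nJ.mono_of_le hle)).1 b
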